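/- (1) Let $\tilde U$ be a group and let $U$ be a characteristic subgroup of $\tilde U$ of index $2$. Suppose that the centre of $U$ is trivial and that every automorphism of $U$ extends to an automorphism of $\tilde U$. Then $\mathrm{Aut}(U)\cong\mathrm{Aut}(\tilde U)$. (2) Let $q$ be an odd prime power, let $F$ be a field with $q^2$ elements, and let $\sigma$ be the automorphism $x\mapsto x^q$ of $F$. Let $M(q^2)$ be the twisted linear fractional group, that is, the group of all permutations of $F\cup\{\infty\}$ of the form $z\mapsto \frac{az+b}{cz+d}$ with $a,b,c,d\in F$ and $ad-bc$ a non-zero square in $F$, or of the form $z\mapsto \frac{az^{\sigma}+b}{cz^{\sigma}+d}$ with $a,b,c,d\in F$ and $ad-bc$ a non-square in $F$ (with $\infty^\sigma=\infty$ and the usual conventions for $\infty$). Then the automorphism group of $M(q^2)$ is isomorphic to $\mathrm{P\Gamma L}(2,q^2)=\mathrm{PGL}(2,F)\rtimes\mathrm{Aut}(F)$, where $\mathrm{Aut}(F)$ acts on $\mathrm{PGL}(2,F)$ entrywise. -/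

import Mathlib

open scoped MatrixGroups

/-- In a finite field with `q ^ 2` elements, the map `x ↦ x ^ q` is additive. -/
theorem add_pow_of_card_eq_sq {F : Type*} [Field F] [Finite F] {q : ℕ}
    (hF : Nat.card F = q ^ 2) (x y : F) : (x + y) ^ q = x ^ q + y ^ q := by
  obtain ⟨p, hp⟩ := CharP.exists F
  have := Fintype.ofFinite F
  obtain ⟨n, hprime, hn⟩ := FiniteField.card F p
  have : Fact p.Prime := ⟨hprime⟩
  rw [Nat.card_eq_fintype_card, hn] at hF
  obtain ⟨f, -, rfl⟩ := (Nat.dvd_prime_pow hprime).1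
    (show q ∣ p ^ (n : ℕ) by rw [hF]; exact dvd_pow_self q two_ne_zero)
  exact add_pow_char_pow x y p f

theorem pow_pow_of_card_eq_sq {F : Type*} [Field F] [Finite F] {q : ℕ}
    (hF : Nat.card F = q ^ 2) (x : F) : (x ^ q) ^ q = x := by
  have := Fintype.ofFinite F
  rw [← pow_mul, ← sq, ← hF, Nat.card_eq_fintype_card, FiniteField.pow_card]

/-- The automorphism `σ : x ↦ x ^ q` of a field with `q ^ 2` elements. -/
def sigmaAut {F : Type*} [Field F] [Finite F] {q : ℕ} (hF : Nat.card F = q ^ 2) : F ≃+* F where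
  toFun x := x ^ q
  invFun x := x ^ q
  left_inv := pow_pow_of_card_eq_sq hF
  right_inv := pow_pow_of_card_eq_sq hF
  map_mul' x y := mul_pow x y q
  map_add' := add_pow_of_card_eq_sq hF

/-- The linear fractional transformation `z ↦ (a z + b) / (c z + d)` of `F ∪ {∞}`
given by the matrix `A = (a, b; c, d)`. -/
def linFrac {F : Type*} [Field F] [DecidableEq F] (A : GL (Fin 2) F) :
    Equiv.Perm (OnePoint F) :=
  MulAction.toPerm A

/-- The permutation `z ↦ φ z` of `F ∪ {∞}` given by a field automorphism `φ`; it fixes `∞`. -/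
def fieldPerm {F : Type*} [Field F] (φ : F ≃+* F) : Equiv.Perm (OnePoint F) where
  toFun := OnePoint.map φ
  invFun := OnePoint.map φ.symm
  left_inv z := by cases z <;> simp
  right_inv z := by cases z <;> simp

theorem linFrac_mul {F : Type*} [Field F] [DecidableEq F] (A B : GL (Fin 2) F) :
    linFrac A * linFrac B = linFrac (A * B) :=
  Equiv.ext fun z => (mul_smul A B z).symm

theorem fieldPerm_mul_linFrac {F : Type*} [Field F] [DecidableEq F] (φ : F ≃+* F)
    (A : GL (Fin 2) F) :
    fieldPerm φ * linFrac A = linFrac (A.map (φ : F →+* F)) * fieldPerm φ :=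
  Equiv.ext fun z => OnePoint.map_smul (φ : F →+* F) A z

theorem fieldPerm_sigmaAut_mul_self {F : Type*} [Field F] [Finite F] {q : ℕ}
    (hF : Nat.card F = q ^ 2) : fieldPerm (sigmaAut hF) * fieldPerm (sigmaAut hF) = 1 := by
  refine Equiv.ext fun z => ?_
  cases z with
  | infty => rfl
  | coe x => exact congrArg OnePoint.some (pow_pow_of_card_eq_sq hF x)

theorem isSquare_mul_iff_of_finite {F : Type*} [Field F] [Finite F] {a b : F}
    (ha : a ≠ 0) (hb : b ≠ 0) : IsSquare (a * b) ↔ (IsSquare a ↔ IsSquare b) := by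
  classical
  have := Fintype.ofFinite F
  rw [← quadraticChar_one_iff_isSquare ha, ← quadraticChar_one_iff_isSquare hb,
    ← quadraticChar_one_iff_isSquare (mul_ne_zero ha hb), map_mul]
  rcases quadraticChar_dichotomy ha with h | h <;> rcases quadraticChar_dichotomy hb with h' | h' <;>
    rw [h, h'] <;> decide

theorem isSquare_map_iff {F : Type*} [Field F] (φ : F ≃+* F) (a : F) :
    IsSquare (φ a) ↔ IsSquare a :=
  ⟨fun h => by simpa using h.map φ.symm, fun h => h.map φ⟩

theorem det_map_val {F : Type*} [Field F] (φ : F ≃+* F) (A : GL (Fin 2) F) :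
    (A.map (φ : F →+* F)).val.det = φ A.val.det :=
  (RingHom.map_det (φ : F →+* F) A.val).symm

/-- The twisted linear fractional group `M(q ^ 2)` over a field `F` with `q ^ 2` elements:
the permutations `z ↦ (a z + b) / (c z + d)` of `F ∪ {∞}` with `a d - b c` a nonzero square,
together with the permutations `z ↦ (a (σ z) + b) / (c (σ z) + d)` with `a d - b c` a nonsquare,
where `σ z = z ^ q`. -/
def twistedLinFracGroup {F : Type*} [Field F] [Finite F] [DecidableEq F] {q : ℕ}
    (hF : Nat.card F = q ^ 2) : Subgroup (Equiv.Perm (OnePoint F)) where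
  carrier := {g | ∃ A : GL (Fin 2) F,
    (IsSquare A.val.det ∧ g = linFrac A) ∨
    (¬ IsSquare A.val.det ∧ g = linFrac A * fieldPerm (sigmaAut hF))}
  one_mem' := ⟨1, Or.inl ⟨by simp, Equiv.ext fun z => (one_smul (GL (Fin 2) F) z).symm⟩⟩
  mul_mem' := by
    have hd : ∀ A B : GL (Fin 2) F, IsSquare (A * B).val.det ↔
        (IsSquare A.val.det ↔ IsSquare B.val.det) := fun A B => by
      rw [Units.val_mul, Matrix.det_mul]
      exact isSquare_mul_iff_of_finite A.det_ne_zero B.det_ne_zero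
    have hs : ∀ B : GL (Fin 2) F, IsSquare (B.map (sigmaAut hF : F →+* F)).val.det ↔
        IsSquare B.val.det := fun B => by rw [det_map_val, isSquare_map_iff]
    rintro _ _ ⟨A, ⟨hA, rfl⟩ | ⟨hA, rfl⟩⟩ ⟨B, ⟨hB, rfl⟩ | ⟨hB, rfl⟩⟩
    · exact ⟨A * B, Or.inl ⟨by rw [hd]; tauto, linFrac_mul A B⟩⟩
    · exact ⟨A * B, Or.inr ⟨by rw [hd]; tauto, by rw [← mul_assoc, linFrac_mul]⟩⟩
    · refine ⟨A * B.map (sigmaAut hF : F →+* F), Or.inr ⟨by rw [hd, hs]; tauto, ?_⟩⟩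
      rw [mul_assoc, fieldPerm_mul_linFrac, ← mul_assoc, linFrac_mul]
    · refine ⟨A * B.map (sigmaAut hF : F →+* F), Or.inl ⟨by rw [hd, hs]; tauto, ?_⟩⟩
      rw [mul_assoc, ← mul_assoc (fieldPerm _), fieldPerm_mul_linFrac, mul_assoc,
        fieldPerm_sigmaAut_mul_self, mul_one, linFrac_mul]
  inv_mem' := by
    have hd : ∀ A : GL (Fin 2) F, IsSquare (A⁻¹).val.det ↔ IsSquare A.val.det := fun A => by
      have h := isSquare_mul_iff_of_finite A.det_ne_zero (A⁻¹).det_ne_zero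
      rw [← Matrix.det_mul, ← Units.val_mul, mul_inv_cancel, Units.val_one, Matrix.det_one] at h
      exact (h.1 IsSquare.one).symm
    have hi : ∀ A : GL (Fin 2) F, (linFrac A)⁻¹ = linFrac A⁻¹ := fun A => Equiv.ext fun _ => rfl
    rintro _ ⟨A, ⟨hA, rfl⟩ | ⟨hA, rfl⟩⟩
    · exact ⟨A⁻¹, Or.inl ⟨(hd A).2 hA, hi A⟩⟩
    · refine ⟨A⁻¹.map (sigmaAut hF : F →+* F), Or.inr ⟨?_, ?_⟩⟩
      · rwa [det_map_val, isSquare_map_iff, hd]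
      · rw [mul_inv_rev, inv_eq_of_mul_eq_one_left (fieldPerm_sigmaAut_mul_self hF), hi,
          fieldPerm_mul_linFrac]

/-- The action of the field automorphisms of `F` on `PGL(2, F)`, entry by entry. -/
def galPGL (F : Type*) [Field F] : RingAut F →* MulAut (PGL(2, F)) where
  toFun φ := MonoidHom.toMulEquiv
    (Matrix.ProjGenLinGroup.map (φ : F →+* F)) (Matrix.ProjGenLinGroup.map (φ.symm : F →+* F))
    (by rw [← Matrix.ProjGenLinGroup.map_comp]; simp [Matrix.ProjGenLinGroup.map_id])
    (by rw [← Matrix.ProjGenLinGroup.map_comp]; simp [Matrix.ProjGenLinGroup.map_id])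
  map_one' := MulEquiv.ext fun g =>
    DFunLike.congr_fun (Matrix.ProjGenLinGroup.map_id (n := Fin 2) (R := F)) g
  map_mul' φ ψ := MulEquiv.ext fun g =>
    DFunLike.congr_fun (Matrix.ProjGenLinGroup.map_comp (n := Fin 2)
      (ψ : F →+* F) (φ : F →+* F)) g

/-- `PΓL(2, F) = PGL(2, F) ⋊ Aut(F)`. -/
abbrev PGammaL2 (F : Type*) [Field F] : Type _ :=
  PGL(2, F) ⋊[galPGL F] RingAut F

/-!
For the first part, two automorphisms `β`, `γ` of `G` that agree on `U` are equal: for `g` in `G`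
the element `(γ g)⁻¹ * β g` lies in `U`, because the characteristic subgroup `U` has index two, and
it centralizes `U`, because `β` and `γ` agree on the conjugates of elements of `U` by `g`
(`MulAut.eq_of_eqOn_of_index_eq_two`). Hence extension of automorphisms from `U` to `G` is a
homomorphism, and it is inverse to restriction.

For the second part, write `M` for `M(q ^ 2)`, acting on the projective line `F ∪ {∞}`. The proof
shows that `Aut(M)` is the normalizer of `M` in the symmetric group on the projective line, and that
this normalizer is `PΓL(2, F)`.

Call `g` in `M` unipotent if `g ^ q = 1`. As `q` is odd, such a `g` lies in `PSL(2, F)`, and if it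
fixes `∞` it is a translation `z ↦ z + b`, since a multiplier `c` would satisfy `c ^ q = 1`
(`exists_eq_translation`). By transitivity, the unipotent elements fixing a given point commute with
each other, and a nontrivial one fixes no other point; it does fix a point, since the number
`q ^ 2 + 1` of points is prime to the characteristic. An automorphism of `M` permutes the unipotent
elements and preserves commutation, so it induces a permutation `π` of the projective line, and the
automorphism is conjugation by `π` (`exists_perm_of_mulAut`).

If a permutation `π` normalizes `M`, composing it with an element of `PGL(2, F)` makes it fix `∞`,
`0` and `1`. It normalizes the group of translations, so it is additive on `F`. A homothety
`z ↦ t ^ 2 z` is a product of transvections, which are unipotent, so its conjugate by `π` lies in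
`PSL(2, F)` and fixes `0` and `∞`, and hence is again a homothety; thus `π (s x) = π s * π x` for
every square `s`. Every element of `F` is a difference of two squares, so `π` is a field
automorphism (`exists_eq_fieldPerm_of_mem_normalizer`).
-/

/-! ### Extending automorphisms from a subgroup of index two -/

/-- An extension to `G` of an automorphism of `U` is unique, because two extensions differ on an
element of `G` by an element of `U` centralizing `U`. -/
theorem MulAut.eq_of_eqOn_of_index_eq_two {G : Type*} [Group G] {U : Subgroup G}
    (hU : U.Characteristic) (h2 : U.index = 2) (hc : Subgroup.center U = ⊥) {β γ : MulAut G}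
    (h : ∀ u : U, β u = γ u) : β = γ := by
  have hn := Subgroup.normal_of_index_eq_two h2
  have hmem : ∀ (δ : MulAut G) (x : G), δ x ∈ U ↔ x ∈ U := fun δ x =>
    Subgroup.ext_iff.1 (Subgroup.characteristic_iff_comap_eq.1 hU δ) x
  ext g
  have hk : (γ g)⁻¹ * β g ∈ U := by
    rw [Subgroup.mul_mem_iff_of_index_two h2, inv_mem_iff, hmem, hmem]
  have hz : (⟨_, hk⟩ : U) ∈ Subgroup.center U := by
    rw [Subgroup.mem_center_iff]
    rintro ⟨v, hv⟩
    obtain ⟨u, rfl⟩ := β.surjective v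
    rw [hmem] at hv
    have h1 := h ⟨_, hn.conj_mem u hv g⟩
    have h3 := h ⟨u, hv⟩
    simp only [map_mul, map_inv] at h1 h3
    apply Subtype.ext
    change β u * ((γ g)⁻¹ * β g) = (γ g)⁻¹ * β g * β u
    have e : β g * β u = γ g * β u * (γ g)⁻¹ * β g := by
      rw [← mul_inv_eq_iff_eq_mul, h1, ← h3]
    rw [mul_assoc _ (β g), e]
    group
  rw [hc, Subgroup.mem_bot, Subtype.ext_iff] at hz
  exact (inv_mul_eq_one.1 hz).symm

theorem nonempty_mulAut_mulEquiv_of_characteristic_of_index_eq_two {G : Type*} [Group G]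
    (U : Subgroup G) (hU : U.Characteristic) (h2 : U.index = 2) (hc : Subgroup.center U = ⊥)
    (hext : ∀ α : MulAut U, ∃ β : MulAut G, ∀ u : U, β (u : G) = (α u : G)) :
    Nonempty (MulAut U ≃* MulAut G) := by
  choose E hE using hext
  let Φ : MulAut U →* MulAut G := MonoidHom.mk' E fun α α' =>
    MulAut.eq_of_eqOn_of_index_eq_two hU h2 hc fun u => by
      rw [hE, MulAut.mul_apply, MulAut.mul_apply, hE, hE]
  refine ⟨MulEquiv.ofBijective Φ ⟨fun α α' h => ?_, fun β => ?_⟩⟩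
  · ext u
    rw [← hE, ← hE]
    exact DFunLike.congr_fun h (u : G)
  · refine ⟨(β.subgroupMap U).trans
      (MulEquiv.subgroupCongr (Subgroup.characteristic_iff_map_eq.1 hU β)), ?_⟩
    exact MulAut.eq_of_eqOn_of_index_eq_two hU h2 hc fun u => hE _ u

/-! ### Linear fractional permutations and `PΓL(2, F)` -/

section LinearFractional

variable {F : Type*} [Field F] [DecidableEq F]

/-- The permutation `z ↦ (a z + b) / (c z + d)` of `F ∪ {∞}`. -/
def moebius (a b c d : F) (h : a * d - b * c ≠ 0) : Equiv.Perm (OnePoint F) :=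
  linFrac (Matrix.GeneralLinearGroup.mkOfDetNeZero !![a, b; c, d] (by rwa [Matrix.det_fin_two_of]))

theorem moebius_infty (a b c d : F) (h : a * d - b * c ≠ 0) :
    moebius a b c d h OnePoint.infty =
      if c = 0 then OnePoint.infty else ((a / c : F) : OnePoint F) :=
  OnePoint.smul_infty_eq_ite _

theorem moebius_coe (a b c d : F) (h : a * d - b * c ≠ 0) (z : F) :
    moebius a b c d h (z : OnePoint F) =
      if c * z + d = 0 then OnePoint.infty else (((a * z + b) / (c * z + d) : F) : OnePoint F) :=
  OnePoint.smul_some_eq_ite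

theorem moebius_mul_moebius (a b c d a' b' c' d' : F) (h : a * d - b * c ≠ 0)
    (h' : a' * d' - b' * c' ≠ 0) :
    moebius a b c d h * moebius a' b' c' d' h' =
      moebius (a * a' + b * c') (a * b' + b * d') (c * a' + d * c') (c * b' + d * d')
        (by convert! mul_ne_zero h h' using 1; ring) := by
  rw [moebius, moebius, linFrac_mul, moebius]
  congr 1
  apply Units.ext
  exact Matrix.mul_fin_two ..

theorem linFrac_coe_of_apply_infty {A : GL (Fin 2) F}
    (h : linFrac A OnePoint.infty = OnePoint.infty) (z : F) :
    A 1 1 ≠ 0 ∧ linFrac A (z : OnePoint F) =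
      ((A 0 0 / A 1 1 * z + A 0 1 / A 1 1 : F) : OnePoint F) := by
  have h10 : A 1 0 = 0 := OnePoint.smul_infty_eq_self_iff.1 h
  have hd := A.det_ne_zero
  rw [Matrix.det_fin_two, h10, mul_zero, sub_zero] at hd
  have h11 := right_ne_zero_of_mul hd
  refine ⟨h11, OnePoint.smul_some_eq_ite.trans ?_⟩
  rw [h10, zero_mul, zero_add, if_neg h11]
  congr 1
  field_simp

theorem linFrac_scalar (u : Fˣ) : linFrac (Matrix.GeneralLinearGroup.scalar (Fin 2) u) = 1 := by
  refine Equiv.ext fun z => ?_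
  cases z with
  | infty => exact (OnePoint.smul_infty_eq_ite _).trans (by simp)
  | coe z => exact OnePoint.smul_some_eq_ite.trans (by simp)

/-- A linear fractional transformation fixing `∞`, `0` and `1` comes from a scalar matrix. -/
theorem exists_scalar_of_linFrac {A : GL (Fin 2) F}
    (h : linFrac A OnePoint.infty = OnePoint.infty)
    (h0 : linFrac A (0 : F) = ((0 : F) : OnePoint F))
    (h1 : linFrac A (1 : F) = ((1 : F) : OnePoint F)) :
    ∃ u, Matrix.GeneralLinearGroup.scalar (Fin 2) u = A := by
  have h10 : A 1 0 = 0 := OnePoint.smul_infty_eq_self_iff.1 h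
  obtain ⟨h11, e0⟩ := linFrac_coe_of_apply_infty h 0
  obtain ⟨-, e1⟩ := linFrac_coe_of_apply_infty h 1
  rw [h0, OnePoint.coe_eq_coe] at e0
  rw [h1, OnePoint.coe_eq_coe] at e1
  refine ⟨Units.mk0 _ h11, ?_⟩
  have h01 : A 0 1 = 0 := by field_simp at e0; simpa using e0.symm
  rw [h01] at e1
  have h00 : A 0 0 = A 1 1 := by field_simp at e1; simpa using e1.symm
  apply Units.ext
  ext i j
  fin_cases i <;> fin_cases j <;> simp [h00, h01, h10]

theorem exists_linFrac_apply_eq_infty (x : OnePoint F) :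
    ∃ A : GL (Fin 2) F, A.val.det = 1 ∧ linFrac A x = OnePoint.infty := by
  cases x with
  | infty => exact ⟨1, by simp, one_smul (GL (Fin 2) F) (OnePoint.infty : OnePoint F)⟩
  | coe x =>
    refine ⟨Matrix.GeneralLinearGroup.mkOfDetNeZero !![0, -1; 1, -x] (by simp), ?_, ?_⟩
    · exact (Matrix.det_fin_two_of ..).trans (by ring)
    · exact (moebius_coe 0 (-1) 1 (-x) (by simp) x).trans (by simp)

/-- `GL(2, F)` is transitive on the triples of distinct points of `F ∪ {∞}`. -/
theorem exists_linFrac_apply_eq {x y z : OnePoint F} (hxy : x ≠ y) (hxz : x ≠ z) (hyz : y ≠ z) :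
    ∃ A : GL (Fin 2) F, linFrac A x = OnePoint.infty ∧
      linFrac A y = ((0 : F) : OnePoint F) ∧ linFrac A z = ((1 : F) : OnePoint F) := by
  obtain ⟨A, -, hA⟩ := exists_linFrac_apply_eq_infty x
  obtain ⟨b, hb⟩ := OnePoint.ne_infty_iff_exists.1
    (hA ▸ (linFrac A).injective.ne hxy.symm : linFrac A y ≠ OnePoint.infty)
  obtain ⟨c, hc⟩ := OnePoint.ne_infty_iff_exists.1
    (hA ▸ (linFrac A).injective.ne hxz.symm : linFrac A z ≠ OnePoint.infty)
  have hbc : c - b ≠ 0 := by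
    rw [sub_ne_zero]
    rintro rfl
    exact hyz ((linFrac A).injective (hb.symm.trans hc))
  have hd : 1 * (c - b) - -b * 0 ≠ 0 := by simpa
  have hB : ∀ t, moebius 1 (-b) 0 (c - b) hd t =
      linFrac (Matrix.GeneralLinearGroup.mkOfDetNeZero !![1, -b; 0, c - b]
        (by rwa [Matrix.det_fin_two_of])) t := fun _ => rfl
  refine ⟨Matrix.GeneralLinearGroup.mkOfDetNeZero !![1, -b; 0, c - b]
    (by rwa [Matrix.det_fin_two_of]) * A, ?_⟩
  rw [← linFrac_mul]
  simp only [Equiv.Perm.mul_apply, ← hB, hA, ← hb, ← hc, moebius_infty, moebius_coe]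
  simp [hbc, ← sub_eq_add_neg]

variable (F) in
/-- The group `PGL(2, F)` as a group of permutations of `F ∪ {∞}`. -/
def pglPerm : PGL(2, F) →* Equiv.Perm (OnePoint F) :=
  Matrix.ProjGenLinGroup.lift (MulAction.toPermHom (GL (Fin 2) F) (OnePoint F))
    (MonoidHom.ext linFrac_scalar)

variable (F) in
/-- The field automorphisms as permutations of `F ∪ {∞}`. -/
def fieldPermHom : RingAut F →* Equiv.Perm (OnePoint F) where
  toFun := fieldPerm
  map_one' := Equiv.ext fun z => by cases z <;> rfl
  map_mul' φ ψ := Equiv.ext fun z => by cases z <;> rfl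

variable (F) in
/-- The group `PΓL(2, F)` as a group of permutations of `F ∪ {∞}`. -/
def pGammaLPerm : PGammaL2 F →* Equiv.Perm (OnePoint F) :=
  SemidirectProduct.lift (pglPerm F) (fieldPermHom F) fun φ => MonoidHom.ext fun g => by
    induction g using Matrix.ProjGenLinGroup.induction_on with | mk A =>
    exact eq_mul_inv_of_mul_eq (fieldPerm_mul_linFrac φ A).symm

theorem pGammaLPerm_mk (A : GL (Fin 2) F) (φ : RingAut F) :
    pGammaLPerm F ⟨Matrix.ProjGenLinGroup.mk A, φ⟩ = linFrac A * fieldPerm φ := rfl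

theorem pGammaLPerm_injective : Function.Injective (pGammaLPerm F) := by
  rw [injective_iff_map_eq_one]
  rintro ⟨g, φ⟩ h
  induction g using Matrix.ProjGenLinGroup.induction_on with | mk A =>
  rw [pGammaLPerm_mk] at h
  have hx : ∀ x, linFrac A (fieldPerm φ x) = x := fun x => DFunLike.congr_fun h x
  obtain ⟨u, rfl⟩ := exists_scalar_of_linFrac (hx OnePoint.infty)
    (by simpa [fieldPerm] using hx (0 : F)) (by simpa [fieldPerm] using hx (1 : F))
  have hφ : φ = 1 := by
    ext z
    have := hx (z : F)
    rw [linFrac_scalar] at this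
    exact OnePoint.coe_injective this
  subst hφ
  rw [Matrix.ProjGenLinGroup.mk_scalar]
  rfl

end LinearFractional

/-! ### The group `PSL(2, F)`, translations and homotheties -/

section SquareDeterminant

variable {F : Type*} [Field F] [DecidableEq F]

variable (F) in
/-- The linear fractional transformations whose determinant is a nonzero square, that is,
`PSL(2, F)` as a group of permutations of `F ∪ {∞}`. -/
def squareLinFracGroup : Subgroup (Equiv.Perm (OnePoint F)) where
  carrier := {g | ∃ A : GL (Fin 2) F, IsSquare A.val.det ∧ g = linFrac A}
  one_mem' := ⟨1, by simp, Equiv.ext fun z => (one_smul (GL (Fin 2) F) z).symm⟩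
  mul_mem' := by
    rintro _ _ ⟨A, hA, rfl⟩ ⟨B, hB, rfl⟩
    exact ⟨A * B, by rw [Units.val_mul, Matrix.det_mul]; exact hA.mul hB, linFrac_mul A B⟩
  inv_mem' := by
    rintro _ ⟨A, hA, rfl⟩
    refine ⟨A⁻¹, ?_, rfl⟩
    have h : IsSquare (A⁻¹.val.det * A.val.det) := by
      rw [← Matrix.det_mul, ← Units.val_mul, inv_mul_cancel, Units.val_one, Matrix.det_one]
      exact IsSquare.one
    simpa [mul_assoc, A.det_ne_zero] using h.mul hA.inv

theorem moebius_mem_squareLinFracGroup {a b c d : F} (h : a * d - b * c ≠ 0)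
    (hs : IsSquare (a * d - b * c)) : moebius a b c d h ∈ squareLinFracGroup F :=
  ⟨_, (Matrix.det_fin_two_of a b c d).symm ▸ hs, rfl⟩

/-- The stabilizer of `∞` in `PSL(2, F)` consists of the maps `z ↦ c z + e` with `c` a nonzero
square. -/
theorem exists_affine_of_mem_squareLinFracGroup {g : Equiv.Perm (OnePoint F)}
    (hg : g ∈ squareLinFracGroup F) (h : g OnePoint.infty = OnePoint.infty) :
    ∃ c e : F, IsSquare c ∧ ∀ z : F, g z = ((c * z + e : F) : OnePoint F) := by
  obtain ⟨A, hA, rfl⟩ := hg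
  refine ⟨_, _, ?_, fun z => (linFrac_coe_of_apply_infty h z).2⟩
  have h11 := (linFrac_coe_of_apply_infty h 0).1
  have h10 : A 1 0 = 0 := OnePoint.smul_infty_eq_self_iff.1 h
  rw [Matrix.det_fin_two, h10, mul_zero, sub_zero] at hA
  have e : A 0 0 / A 1 1 = A 0 0 * A 1 1 * ((A 1 1)⁻¹) ^ 2 := by field_simp
  rw [e]
  exact hA.mul (IsSquare.sq _)

/-- The translation `z ↦ z + b`, fixing `∞`. -/
def translation (b : F) : Equiv.Perm (OnePoint F) := moebius 1 b 0 1 (by simp)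

@[simp] theorem translation_infty (b : F) :
    translation b OnePoint.infty = OnePoint.infty := by
  simp [translation, moebius_infty]

@[simp] theorem translation_coe (b z : F) :
    translation b (z : OnePoint F) = ((z + b : F) : OnePoint F) := by
  simp [translation, moebius_coe]

theorem translation_mem (b : F) : translation b ∈ squareLinFracGroup F :=
  moebius_mem_squareLinFracGroup _ (by simp)

theorem translation_pow (b : F) (n : ℕ) : translation b ^ n = translation (n * b) := by
  induction n with
  | zero =>
    refine Equiv.ext fun z => ?_
    cases z <;> simp
  | succ n ih =>
    refine Equiv.ext fun z => ?_
    rw [pow_succ, ih]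
    cases z
    · simp
    · simp; ring

/-- The inversion `z ↦ -1 / z`. -/
def inversion : Equiv.Perm (OnePoint F) := moebius 0 (-1) 1 0 (by simp)

theorem inversion_mem : (inversion : Equiv.Perm (OnePoint F)) ∈ squareLinFracGroup F :=
  moebius_mem_squareLinFracGroup _ (by simp)

theorem moebius_congr {a b c d a' b' c' d' : F} {h : a * d - b * c ≠ 0}
    {h' : a' * d' - b' * c' ≠ 0} (ha : a = a') (hb : b = b') (hc : c = c') (hd : d = d') :
    moebius a b c d h = moebius a' b' c' d' h' := by
  subst ha hb hc hd
  rfl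

theorem inversion_conj_translation (b : F) :
    inversion * translation b * inversion⁻¹ = moebius 1 0 (-b) 1 (by simp) := by
  rw [mul_inv_eq_iff_eq_mul, inversion, translation, moebius_mul_moebius, moebius_mul_moebius]
  exact moebius_congr (by ring) (by ring) (by ring) (by ring)

/-- The homothety `z ↦ t ^ 2 z`, given by the matrix `(t, 0; 0, t⁻¹)`, is a product of six
transvections: with `w t = (0, t; -t⁻¹, 0)`, itself a product of three transvections, it is
`w t * w (-1)`. -/
theorem moebius_diag_eq (t : F) (ht : t ≠ 0) :
    moebius t 0 0 t⁻¹ (by simp [ht]) =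
      translation t * (inversion * translation t⁻¹ * inversion⁻¹) * translation t *
        (translation (-1) * (inversion * translation (-1) * inversion⁻¹) * translation (-1)) := by
  simp only [inversion_conj_translation]
  simp only [translation, moebius_mul_moebius]
  apply moebius_congr <;> field_simp <;> ring

end SquareDeterminant

/-! ### Unipotent elements of `M(q ^ 2)` -/

section Twisted

variable {F : Type*} [Field F] [Finite F] {q : ℕ}

theorem natCast_eq_zero_of_card_eq_sq (hF : Nat.card F = q ^ 2) : (q : F) = 0 := by
  have h : ((Nat.card F : ℕ) : F) = 0 := by
    have := Fintype.ofFinite F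
    rw [Nat.card_eq_fintype_card, Nat.cast_card_eq_zero]
  rw [hF, Nat.cast_pow] at h
  exact pow_eq_zero_iff two_ne_zero |>.1 h

theorem two_ne_zero_of_card_eq_sq (hq : Odd q) (hF : Nat.card F = q ^ 2) : (2 : F) ≠ 0 := by
  intro h
  obtain ⟨k, hk⟩ := hq
  have h0 := natCast_eq_zero_of_card_eq_sq hF
  rw [hk] at h0
  push_cast at h0
  rw [h, zero_mul, zero_add] at h0
  exact one_ne_zero h0

/-- The projective line has `q ^ 2 + 1` points, so a permutation of `q`-power order fixes one. -/
theorem exists_apply_eq_self_of_pow_eq_one (hF : Nat.card F = q ^ 2)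
    {g : Equiv.Perm (OnePoint F)} (hg : g ^ q = 1) : ∃ x, g x = x := by
  obtain ⟨p, hp⟩ := CharP.exists F
  have := Fintype.ofFinite F
  obtain ⟨n, hprime, hn⟩ := FiniteField.card F p
  have : Fact p.Prime := ⟨hprime⟩
  have hF' := hF
  rw [Nat.card_eq_fintype_card, hn] at hF'
  obtain ⟨f, -, rfl⟩ := (Nat.dvd_prime_pow hprime).1
    (show q ∣ p ^ (n : ℕ) by rw [hF']; exact dvd_pow_self q two_ne_zero)
  have : Fintype (OnePoint F) := inferInstanceAs (Fintype (Option F))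
  refine Equiv.Perm.exists_fixed_point_of_prime (p := p) (n := f) ?_ hg
  have hcard : Fintype.card (OnePoint F) = p ^ (n : ℕ) + 1 := by
    rw [← hn]
    rw [← Nat.card_eq_fintype_card, ← Nat.card_eq_fintype_card]
    exact Finite.card_option
  rw [hcard, Nat.dvd_add_right (dvd_pow_self p n.ne_zero)]
  exact hprime.one_lt.not_ge ∘ Nat.le_of_dvd one_pos

variable [DecidableEq F]

theorem squareLinFracGroup_le (hF : Nat.card F = q ^ 2) :
    squareLinFracGroup F ≤ twistedLinFracGroup hF :=
  fun _ ⟨A, hA, h⟩ => ⟨A, Or.inl ⟨hA, h⟩⟩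

theorem mul_self_mem_squareLinFracGroup (hq : Odd q) (hF : Nat.card F = q ^ 2)
    {g : Equiv.Perm (OnePoint F)} (hg : g ∈ twistedLinFracGroup hF) :
    g * g ∈ squareLinFracGroup F := by
  obtain ⟨A, ⟨hA, rfl⟩ | ⟨-, rfl⟩⟩ := hg
  · exact mul_mem (⟨A, hA, rfl⟩ : _ ∈ squareLinFracGroup F) ⟨A, hA, rfl⟩
  · refine ⟨A * A.map (sigmaAut hF : F →+* F), ?_, ?_⟩
    · rw [Units.val_mul, Matrix.det_mul, det_map_val]
      change IsSquare (A.val.det * A.val.det ^ q)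
      rw [← pow_succ']
      exact hq.add_one.isSquare_pow _
    · rw [mul_assoc, ← mul_assoc (fieldPerm _), fieldPerm_mul_linFrac, mul_assoc,
        fieldPerm_sigmaAut_mul_self, mul_one, linFrac_mul]

/-- Elements of odd order of `M(q ^ 2)` lie in the subgroup `PSL(2, F)` of index two. -/
theorem mem_squareLinFracGroup_of_pow_eq_one (hq : Odd q) (hF : Nat.card F = q ^ 2)
    {g : Equiv.Perm (OnePoint F)} (hg : g ∈ twistedLinFracGroup hF) (h1 : g ^ q = 1) :
    g ∈ squareLinFracGroup F := by
  obtain ⟨k, rfl⟩ := hq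
  have h2 := pow_mem (mul_self_mem_squareLinFracGroup ⟨k, rfl⟩ hF hg) k
  rw [pow_succ, pow_mul, sq] at h1
  rw [← inv_eq_of_mul_eq_one_right h1]
  exact inv_mem h2

theorem translation_pow_eq_one (hF : Nat.card F = q ^ 2) (b : F) : translation b ^ q = 1 := by
  rw [translation_pow, natCast_eq_zero_of_card_eq_sq hF, zero_mul]
  refine Equiv.ext fun z => ?_
  cases z <;> simp

/-- In `M(q ^ 2)` the solutions of `g ^ q = 1` fixing `∞` are the translations. -/
theorem exists_eq_translation (hq : Odd q) (hF : Nat.card F = q ^ 2)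
    {g : Equiv.Perm (OnePoint F)} (hg : g ∈ twistedLinFracGroup hF) (h1 : g ^ q = 1)
    (h : g OnePoint.infty = OnePoint.infty) : ∃ b, g = translation b := by
  obtain ⟨c, e, -, hce⟩ := exists_affine_of_mem_squareLinFracGroup
    (mem_squareLinFracGroup_of_pow_eq_one hq hF hg h1) h
  have key : ∀ n : ℕ, ∃ e', ∀ z : F, (g ^ n) z = ((c ^ n * z + e' : F) : OnePoint F) := by
    intro n
    induction n with
    | zero => exact ⟨0, fun z => by simp⟩
    | succ n ih =>
      obtain ⟨e', he'⟩ := ih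
      refine ⟨c ^ n * e + e', fun z => ?_⟩
      rw [pow_succ, Equiv.Perm.mul_apply, hce, he']
      congr 1
      ring
  obtain ⟨e', he'⟩ := key q
  rw [h1] at he'
  have h0 : e' = 0 := by simpa using (OnePoint.coe_injective (he' 0)).symm
  have hc : c ^ q = 1 := by simpa [h0] using (OnePoint.coe_injective (he' 1)).symm
  -- `x ↦ x ^ q` is injective, so the multiplier of `g` is trivial.
  have hc1 : c = 1 := by rw [← pow_pow_of_card_eq_sq hF c, hc, one_pow]
  refine ⟨e, Equiv.ext fun z => ?_⟩
  cases z with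
  | infty => rw [h, translation_infty]
  | coe z => rw [hce, translation_coe, hc1, one_mul]

/-- The solutions of `g ^ q = 1` in `M(q ^ 2)`. As `q` is a power of the characteristic, these are
the unipotent elements. -/
def unipotents (hF : Nat.card F = q ^ 2) : Set (Equiv.Perm (OnePoint F)) :=
  {g | g ∈ twistedLinFracGroup hF ∧ g ^ q = 1}

theorem conj_mem_unipotents {hF : Nat.card F = q ^ 2} {g h : Equiv.Perm (OnePoint F)}
    (hg : g ∈ unipotents hF) (hh : h ∈ twistedLinFracGroup hF) : h * g * h⁻¹ ∈ unipotents hF :=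
  ⟨mul_mem (mul_mem hh hg.1) (inv_mem hh), by rw [conj_pow, hg.2, mul_one, mul_inv_cancel]⟩

theorem translation_mem_unipotents (hF : Nat.card F = q ^ 2) (b : F) :
    translation b ∈ unipotents hF :=
  ⟨squareLinFracGroup_le hF (translation_mem b), translation_pow_eq_one hF b⟩

theorem exists_mem_apply_eq_infty (hF : Nat.card F = q ^ 2) (x : OnePoint F) :
    ∃ h ∈ twistedLinFracGroup hF, h x = OnePoint.infty := by
  obtain ⟨A, hA, hx⟩ := exists_linFrac_apply_eq_infty x
  exact ⟨_, squareLinFracGroup_le hF ⟨A, hA ▸ IsSquare.one, rfl⟩, hx⟩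

/-- The unipotent elements fixing a point `x` are the conjugates of the translations by any
element of `M(q ^ 2)` that moves `x` to `∞`. -/
theorem exists_conj_eq_translation (hq : Odd q) {hF : Nat.card F = q ^ 2}
    {g h : Equiv.Perm (OnePoint F)} (hg : g ∈ unipotents hF) (hh : h ∈ twistedLinFracGroup hF)
    {x : OnePoint F} (hx : h x = OnePoint.infty) (hgx : g x = x) :
    ∃ b, h * g * h⁻¹ = translation b := by
  have h' := conj_mem_unipotents hg hh
  refine exists_eq_translation hq hF h'.1 h'.2 ?_
  rw [Equiv.Perm.mul_apply, Equiv.Perm.mul_apply, Equiv.Perm.inv_eq_iff_eq.2 hx.symm, hgx, hx]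

/-- A nontrivial unipotent element fixes at most one point. -/
theorem eq_one_of_mem_unipotents (hq : Odd q) {hF : Nat.card F = q ^ 2}
    {g : Equiv.Perm (OnePoint F)} (hg : g ∈ unipotents hF) {x y : OnePoint F} (hxy : x ≠ y)
    (hx : g x = x) (hy : g y = y) : g = 1 := by
  obtain ⟨h, hh, hhx⟩ := exists_mem_apply_eq_infty hF x
  obtain ⟨b, hb⟩ := exists_conj_eq_translation hq hg hh hhx hx
  obtain ⟨z, hz⟩ := OnePoint.ne_infty_iff_exists.1 (hhx ▸ h.injective.ne hxy.symm :
    h y ≠ OnePoint.infty)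
  have hbz : translation b (z : OnePoint F) = z := by
    rw [← hb, hz]
    simp [hy]
  have hb0 : b = 0 := by simpa using hbz
  have h1 : (translation b : Equiv.Perm (OnePoint F)) = 1 := by
    refine Equiv.ext fun z => ?_
    cases z <;> simp [hb0]
  rwa [h1, conj_eq_one_iff] at hb

theorem commute_of_mem_unipotents (hq : Odd q) {hF : Nat.card F = q ^ 2}
    {g g' : Equiv.Perm (OnePoint F)} (hg : g ∈ unipotents hF) (hg' : g' ∈ unipotents hF)
    {x : OnePoint F} (hx : g x = x) (hx' : g' x = x) : Commute g g' := by
  obtain ⟨h, hh, hhx⟩ := exists_mem_apply_eq_infty hF x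
  obtain ⟨b, hb⟩ := exists_conj_eq_translation hq hg hh hhx hx
  obtain ⟨b', hb'⟩ := exists_conj_eq_translation hq hg' hh hhx hx'
  rw [← Commute.conj_iff h, hb, hb']
  refine Equiv.ext fun z => ?_
  cases z
  · simp
  · simp; ring

theorem exists_mem_unipotents_ne_one (hF : Nat.card F = q ^ 2) (x : OnePoint F) :
    ∃ g ∈ unipotents hF, g ≠ 1 ∧ g x = x := by
  obtain ⟨h, hh, hhx⟩ := exists_mem_apply_eq_infty hF x
  refine ⟨h⁻¹ * translation 1 * h, ?_, fun h1 => ?_, ?_⟩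
  · simpa using conj_mem_unipotents (translation_mem_unipotents hF 1) (inv_mem hh)
  · have h2 : (translation 1 : Equiv.Perm (OnePoint F)) = 1 := by
      rwa [← conj_eq_one_iff (a := h⁻¹), inv_inv]
    have := DFunLike.congr_fun h2 ((0 : F) : OnePoint F)
    simp at this
  · rw [Equiv.Perm.mul_apply, Equiv.Perm.mul_apply, hhx, translation_infty,
      Equiv.Perm.inv_eq_iff_eq, hhx]

/-! ### Automorphisms of `M(q ^ 2)` as permutations of the projective line -/

theorem coe_mulAut_mem_unipotents {hF : Nat.card F = q ^ 2}
    (α : MulAut (twistedLinFracGroup hF)) {g : twistedLinFracGroup hF} (hg : g ^ q = 1) :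
    (α g : Equiv.Perm (OnePoint F)) ∈ unipotents hF :=
  ⟨(α g).2, by rw [← Subgroup.coe_pow, ← map_pow, hg, map_one, Subgroup.coe_one]⟩

/-- The relation between points of the projective line induced by an automorphism `α` of
`M(q ^ 2)`: the image under `α` of each unipotent element fixing `x` fixes `y`. -/
def FixesImage {hF : Nat.card F = q ^ 2} (α : MulAut (twistedLinFracGroup hF))
    (x y : OnePoint F) : Prop :=
  ∀ g : twistedLinFracGroup hF, g ^ q = 1 →
    (g : Equiv.Perm (OnePoint F)) x = x → (α g : Equiv.Perm (OnePoint F)) y = y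

theorem FixesImage.eq (hq : Odd q) {hF : Nat.card F = q ^ 2}
    {α : MulAut (twistedLinFracGroup hF)} {x y y' : OnePoint F} (h : FixesImage α x y)
    (h' : FixesImage α x y') : y = y' := by
  obtain ⟨t, ht, ht1, htx⟩ := exists_mem_unipotents_ne_one hF x
  lift t to twistedLinFracGroup hF using ht.1
  have htq : t ^ q = 1 := Subtype.ext ht.2
  by_contra hne
  have := eq_one_of_mem_unipotents hq (coe_mulAut_mem_unipotents α htq) hne (h t htq htx)
    (h' t htq htx)
  rw [OneMemClass.coe_eq_one, EmbeddingLike.map_eq_one_iff] at this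
  exact ht1 (congrArg Subtype.val this)

theorem FixesImage.trans {hF : Nat.card F = q ^ 2} {α β : MulAut (twistedLinFracGroup hF)}
    {x y z : OnePoint F} (h : FixesImage α x y) (h' : FixesImage β y z) :
    FixesImage (β * α) x z := fun g hg hgx =>
  h' (α g) (by rw [← map_pow, hg, map_one]) (h g hg hgx)

theorem FixesImage.smul {hF : Nat.card F = q ^ 2} {α : MulAut (twistedLinFracGroup hF)}
    {x y : OnePoint F} (h : FixesImage α x y) (g : twistedLinFracGroup hF) :
    FixesImage α ((g : Equiv.Perm (OnePoint F)) x) ((α g : Equiv.Perm (OnePoint F)) y) := by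
  intro t ht htx
  have := h (g⁻¹ * t * g) (by simpa [ht] using conj_pow (i := q) (a := g⁻¹) (b := t)) (by
    simp only [Subgroup.coe_mul, Subgroup.coe_inv, Equiv.Perm.mul_apply, htx]
    exact (g : Equiv.Perm (OnePoint F)).symm_apply_apply x)
  simp only [map_mul, map_inv, Subgroup.coe_mul, Subgroup.coe_inv, Equiv.Perm.mul_apply,
    Equiv.Perm.inv_eq_iff_eq] at this
  exact this

/-- A nontrivial unipotent element fixes exactly one point and commutes with all unipotent elements
fixing that point, so every point `x` is related to a point. -/
theorem exists_fixesImage (hq : Odd q) {hF : Nat.card F = q ^ 2}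
    (α : MulAut (twistedLinFracGroup hF)) (x : OnePoint F) : ∃ y, FixesImage α x y := by
  obtain ⟨t, ht, ht1, htx⟩ := exists_mem_unipotents_ne_one hF x
  lift t to twistedLinFracGroup hF using ht.1
  have htq : t ^ q = 1 := Subtype.ext ht.2
  have htα := coe_mulAut_mem_unipotents α htq
  obtain ⟨y, hy⟩ := exists_apply_eq_self_of_pow_eq_one hF htα.2
  refine ⟨y, fun g hg hgx => ?_⟩
  have hcomm : g * t = t * g :=
    Subtype.ext (commute_of_mem_unipotents hq ⟨g.2, congrArg Subtype.val hg⟩ ht hgx htx)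
  have hy' : (α t : Equiv.Perm (OnePoint F)) ((α g : Equiv.Perm (OnePoint F)) y) =
      (α g : Equiv.Perm (OnePoint F)) y := by
    rw [← Equiv.Perm.mul_apply, ← Subgroup.coe_mul, ← map_mul, ← hcomm, map_mul, Subgroup.coe_mul,
      Equiv.Perm.mul_apply, hy]
  by_contra hne
  have := eq_one_of_mem_unipotents hq htα hne hy' hy
  rw [OneMemClass.coe_eq_one, EmbeddingLike.map_eq_one_iff] at this
  exact ht1 (congrArg Subtype.val this)

/-- Every automorphism of `M(q ^ 2)` is induced by a permutation of the projective line. -/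
theorem exists_perm_of_mulAut (hq : Odd q) {hF : Nat.card F = q ^ 2}
    (α : MulAut (twistedLinFracGroup hF)) :
    ∃ π : Equiv.Perm (OnePoint F), ∀ g : twistedLinFracGroup hF,
      (α g : Equiv.Perm (OnePoint F)) = π * g * π⁻¹ := by
  choose f hf using exists_fixesImage hq (hF := hF)
  have hid : ∀ x, FixesImage (1 : MulAut (twistedLinFracGroup hF)) x x := fun _ _ _ h => h
  let π : Equiv.Perm (OnePoint F) :=
    ⟨f α, f α⁻¹, fun x => FixesImage.eq hq (inv_mul_cancel α ▸ (hf α x).trans (hf α⁻¹ _)) (hid x),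
      fun x => FixesImage.eq hq (mul_inv_cancel α ▸ (hf α⁻¹ x).trans (hf α _)) (hid x)⟩
  exact ⟨π, fun g => eq_mul_inv_of_mul_eq <| Equiv.ext fun x =>
    ((hf α x).smul g).eq hq (hf α _)⟩

theorem centralizer_twistedLinFracGroup (hq : Odd q) (hF : Nat.card F = q ^ 2) :
    Subgroup.centralizer (twistedLinFracGroup hF : Set (Equiv.Perm (OnePoint F))) = ⊥ := by
  rw [eq_bot_iff]
  intro π hπ
  rw [Subgroup.mem_centralizer_iff] at hπ
  refine Subgroup.mem_bot.2 (Equiv.ext fun x => ?_)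
  obtain ⟨t, ht, ht1, htx⟩ := exists_mem_unipotents_ne_one hF x
  -- If `π x ≠ x`, then `t`, which commutes with `π`, fixes the two points `π x` and `x`.
  by_contra hne
  refine ht1 (eq_one_of_mem_unipotents hq ht hne ?_ htx)
  rw [← Equiv.Perm.mul_apply, hπ t ht.1, Equiv.Perm.mul_apply, htx]

/-- The automorphism group of `M(q ^ 2)` is its normalizer in the symmetric group on the projective
line. -/
theorem normalizerMonoidHom_bijective (hq : Odd q) (hF : Nat.card F = q ^ 2) :
    Function.Bijective (twistedLinFracGroup hF).normalizerMonoidHom := by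
  constructor
  · rw [← MonoidHom.ker_eq_bot_iff, Subgroup.normalizerMonoidHom_ker,
      centralizer_twistedLinFracGroup hq, Subgroup.bot_subgroupOf]
  · intro α
    obtain ⟨π, hπ⟩ := exists_perm_of_mulAut hq α
    refine ⟨⟨π, Subgroup.mem_normalizer_iff.2 fun g => ⟨fun hg => ?_, fun hg => ?_⟩⟩, ?_⟩
    · exact hπ ⟨g, hg⟩ ▸ (α ⟨g, hg⟩).2
    · obtain ⟨h, hh⟩ := α.surjective ⟨_, hg⟩
      have := (hπ h).symm.trans (congrArg Subtype.val hh)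
      simp only [mul_left_inj, mul_right_inj] at this
      exact this ▸ h.2
    · ext1 g
      exact Subtype.ext (hπ g).symm

end Twisted

/-! ### The normalizer of `M(q ^ 2)` -/

section Normalizer

variable {F : Type*} [Field F] [Finite F] [DecidableEq F] {q : ℕ}

theorem linFrac_mem_normalizer (hq : Odd q) (hF : Nat.card F = q ^ 2) (B : GL (Fin 2) F) :
    linFrac B ∈ Subgroup.normalizer (twistedLinFracGroup hF : Set (Equiv.Perm (OnePoint F))) := by
  have key : ∀ B : GL (Fin 2) F, ∀ g ∈ twistedLinFracGroup hF,
      linFrac B * g * (linFrac B)⁻¹ ∈ twistedLinFracGroup hF := by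
    rintro B _ ⟨A, ⟨hA, rfl⟩ | ⟨hA, rfl⟩⟩
    · refine ⟨B * A * B⁻¹, Or.inl ⟨?_, ?_⟩⟩
      · rwa [Units.val_mul, Units.val_mul, Matrix.det_units_conj]
      · rw [← linFrac_mul, ← linFrac_mul]
        rfl
    · refine ⟨B * A * B⁻¹.map (sigmaAut hF : F →+* F), Or.inr ⟨?_, ?_⟩⟩
      · -- The determinant changes by a power of `det B` with the even exponent `1 - q`.
        obtain ⟨k, rfl⟩ := hq
        have hB : B.val.det * B⁻¹.val.det = 1 := by
          rw [← Matrix.det_mul, ← Units.val_mul, mul_inv_cancel, Units.val_one, Matrix.det_one]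
        have e : (B * A * B⁻¹.map (sigmaAut hF : F →+* F)).val.det =
            A.val.det * (B⁻¹.val.det ^ k) ^ 2 := by
          rw [Units.val_mul, Units.val_mul, Matrix.det_mul, Matrix.det_mul, det_map_val]
          change B.val.det * A.val.det * B⁻¹.val.det ^ (2 * k + 1) = _
          linear_combination A.val.det * (B⁻¹.val.det ^ k) ^ 2 * hB
        rw [e, isSquare_mul_iff_of_finite A.det_ne_zero
          (pow_ne_zero _ (pow_ne_zero _ B⁻¹.det_ne_zero))]
        exact fun h => hA (h.2 (IsSquare.sq _))
      · rw [← mul_assoc, linFrac_mul, ← linFrac_mul _ (B⁻¹.map _), mul_assoc _ _ (fieldPerm _),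
          ← fieldPerm_mul_linFrac, mul_assoc (linFrac (B * A))]; rfl
  refine Subgroup.mem_normalizer_iff.2 fun g => ⟨key B g, fun h => ?_⟩
  have := key B⁻¹ _ h
  have e : linFrac B⁻¹ = (linFrac B)⁻¹ := rfl
  rw [e] at this
  simpa [mul_assoc] using this

theorem fieldPerm_mem_normalizer (hF : Nat.card F = q ^ 2) (φ : RingAut F) :
    fieldPerm φ ∈ Subgroup.normalizer (twistedLinFracGroup hF : Set (Equiv.Perm (OnePoint F))) := by
  have key : ∀ φ : RingAut F, ∀ g ∈ twistedLinFracGroup hF,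
      fieldPerm φ * g * (fieldPerm φ)⁻¹ ∈ twistedLinFracGroup hF := by
    rintro φ _ ⟨A, ⟨hA, rfl⟩ | ⟨hA, rfl⟩⟩
    · refine ⟨A.map (φ : F →+* F), Or.inl ⟨by rwa [det_map_val, isSquare_map_iff], ?_⟩⟩
      rw [fieldPerm_mul_linFrac, mul_inv_cancel_right]
    · refine ⟨A.map (φ : F →+* F), Or.inr ⟨by rwa [det_map_val, isSquare_map_iff], ?_⟩⟩
      have hc : fieldPerm φ * fieldPerm (sigmaAut hF) = fieldPerm (sigmaAut hF) * fieldPerm φ := by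
        refine Equiv.ext fun z => ?_
        cases z with
        | infty => rfl
        | coe z => exact congrArg OnePoint.some (map_pow φ z q)
      rw [← mul_assoc, fieldPerm_mul_linFrac, mul_assoc _ (fieldPerm φ), hc, ← mul_assoc,
        mul_inv_cancel_right]
  refine Subgroup.mem_normalizer_iff.2 fun g => ⟨key φ g, fun h => ?_⟩
  have := key φ⁻¹ _ h
  have e : fieldPerm φ⁻¹ = (fieldPerm φ)⁻¹ := rfl
  rw [e] at this
  simpa [mul_assoc] using this

theorem pGammaLPerm_range_le (hq : Odd q) (hF : Nat.card F = q ^ 2) :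
    (pGammaLPerm F).range ≤
      Subgroup.normalizer (twistedLinFracGroup hF : Set (Equiv.Perm (OnePoint F))) := by
  rintro _ ⟨⟨g, φ⟩, rfl⟩
  induction g using Matrix.ProjGenLinGroup.induction_on with | mk A =>
  rw [pGammaLPerm_mk]
  exact mul_mem (linFrac_mem_normalizer hq hF A) (fieldPerm_mem_normalizer hF φ)

/-- If `π` normalizes `M(q ^ 2)`, it conjugates unipotent elements into `PSL(2, F)`. -/
theorem conj_mem_squareLinFracGroup (hq : Odd q) {hF : Nat.card F = q ^ 2}
    {π : Equiv.Perm (OnePoint F)}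
    (hπ : π ∈ Subgroup.normalizer (twistedLinFracGroup hF : Set (Equiv.Perm (OnePoint F))))
    {g : Equiv.Perm (OnePoint F)} (hg : g ∈ unipotents hF) :
    π * g * π⁻¹ ∈ squareLinFracGroup F := by
  refine mem_squareLinFracGroup_of_pow_eq_one hq hF
    ((Subgroup.mem_normalizer_iff.1 hπ g).1 hg.1) ?_
  rw [conj_pow, hg.2, mul_one, mul_inv_cancel]

/-- If `π` normalizes `M(q ^ 2)`, it conjugates the homotheties by squares into `PSL(2, F)`, since
these are products of unipotent elements. -/
theorem conj_moebius_diag_mem (hq : Odd q) {hF : Nat.card F = q ^ 2}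
    {π : Equiv.Perm (OnePoint F)}
    (hπ : π ∈ Subgroup.normalizer (twistedLinFracGroup hF : Set (Equiv.Perm (OnePoint F))))
    (t : F) (ht : t ≠ 0) :
    π * moebius t 0 0 t⁻¹ (by simp [ht]) * π⁻¹ ∈ squareLinFracGroup F := by
  have hu : ∀ b : F, translation b ∈ (squareLinFracGroup F).comap (MulAut.conj π).toMonoidHom :=
    fun b => conj_mem_squareLinFracGroup hq hπ (translation_mem_unipotents hF b)
  have hl : ∀ b : F, inversion * translation b * inversion⁻¹ ∈
      (squareLinFracGroup F).comap (MulAut.conj π).toMonoidHom := fun b =>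
    conj_mem_squareLinFracGroup hq hπ (conj_mem_unipotents (translation_mem_unipotents hF b)
      (squareLinFracGroup_le hF inversion_mem))
  rw [moebius_diag_eq t ht]
  change _ ∈ (squareLinFracGroup F).comap (MulAut.conj π).toMonoidHom
  exact mul_mem (mul_mem (mul_mem (hu t) (hl _)) (hu t)) (mul_mem (mul_mem (hu _) (hl _)) (hu _))

/-- An additive bijection of a field of characteristic other than two that is multiplicative when
one factor is a square is a field automorphism, because every element is a difference of two
squares. -/
theorem exists_ringAut_of_map_sq_mul {F : Type*} [Field F] (h2 : (2 : F) ≠ 0) (f : F ≃ F)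
    (hadd : ∀ x y, f (x + y) = f x + f y)
    (hsq : ∀ t x, f (t ^ 2 * x) = f (t ^ 2) * f x) : ∃ φ : RingAut F, ∀ x, φ x = f x := by
  let f' : F →+ F := AddMonoidHom.mk' f hadd
  have hmul : ∀ x y, f (x * y) = f x * f y := by
    intro x y
    have hx : x = ((x + 1) / 2) ^ 2 - ((x - 1) / 2) ^ 2 := by field_simp; ring
    have hsub : ∀ a b, f (a - b) = f a - f b := map_sub f'
    rw [hx, sub_mul, hsub, hsub, hsq, hsq, sub_mul]
  exact ⟨{ f with map_mul' := hmul, map_add' := hadd }, fun _ => rfl⟩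

/-- A permutation that normalizes `M(q ^ 2)` and fixes `∞`, `0` and `1` is a field automorphism. -/
theorem exists_eq_fieldPerm_of_mem_normalizer (hq : Odd q) {hF : Nat.card F = q ^ 2}
    {π : Equiv.Perm (OnePoint F)}
    (hπ : π ∈ Subgroup.normalizer (twistedLinFracGroup hF : Set (Equiv.Perm (OnePoint F))))
    (hinf : π OnePoint.infty = OnePoint.infty) (h0 : π (0 : F) = ((0 : F) : OnePoint F))
    (h1 : π (1 : F) = ((1 : F) : OnePoint F)) : ∃ φ : RingAut F, π = fieldPerm φ := by
  have hinf' : π⁻¹ OnePoint.infty = OnePoint.infty := Equiv.Perm.inv_eq_iff_eq.2 hinf.symm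
  obtain ⟨f, hf⟩ : ∃ f : F ≃ F, ∀ z : F, π z = ((f z : F) : OnePoint F) := by
    have : ∀ π : Equiv.Perm (OnePoint F), π OnePoint.infty = OnePoint.infty →
        ∃ f : F → F, ∀ z : F, π z = ((f z : F) : OnePoint F) := by
      intro π hπ
      have h : ∀ z : F, ∃ w : F, (w : OnePoint F) = π z := fun z =>
        OnePoint.ne_infty_iff_exists.1 (hπ ▸ π.injective.ne (OnePoint.coe_ne_infty z))
      choose f hf using h
      exact ⟨f, fun z => (hf z).symm⟩
    obtain ⟨f, hf⟩ := this π hinf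
    obtain ⟨f', hf'⟩ := this π⁻¹ hinf'
    refine ⟨⟨f, f', fun z => ?_, fun z => ?_⟩, hf⟩
    · rw [← OnePoint.coe_eq_coe, ← hf', ← hf]
      exact π.symm_apply_apply _
    · rw [← OnePoint.coe_eq_coe, ← hf, ← hf']
      exact π.apply_symm_apply _
  have hf0 : f 0 = 0 := OnePoint.coe_injective ((hf 0).symm.trans h0)
  have hf1 : f 1 = 1 := OnePoint.coe_injective ((hf 1).symm.trans h1)
  -- `π` normalizes the group of translations.
  have hadd : ∀ x b, f (x + b) = f x + f b := by
    intro x b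
    have hmem := (Subgroup.mem_normalizer_iff.1 hπ _).1 (translation_mem_unipotents hF b).1
    obtain ⟨c, hc⟩ := exists_eq_translation hq hF hmem
      (by rw [conj_pow, translation_pow_eq_one hF, mul_one, mul_inv_cancel])
      (by simp [Equiv.Perm.mul_apply, hinf', hinf])
    rw [mul_inv_eq_iff_eq_mul] at hc
    have h : ∀ z : F, f (z + b) = f z + c := fun z => by
      simpa [hf] using DFunLike.congr_fun hc (z : OnePoint F)
    have hcb : f b = c := by simpa [hf0] using h 0
    rw [h, hcb]
  -- `π` maps the homotheties by squares to homotheties.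
  have hsq : ∀ t x, f (t ^ 2 * x) = f (t ^ 2) * f x := by
    intro t x
    rcases eq_or_ne t 0 with rfl | ht
    · simp [hf0]
    obtain ⟨c, e, -, hce⟩ := exists_affine_of_mem_squareLinFracGroup
      (conj_moebius_diag_mem hq hπ t ht) (by
        rw [Equiv.Perm.mul_apply, Equiv.Perm.mul_apply, hinf', moebius_infty, if_pos rfl, hinf])
    have h : ∀ z : F, f (t ^ 2 * z) = c * f z + e := fun z => by
      have := hce (f z)
      rw [← hf, Equiv.Perm.mul_apply, Equiv.Perm.mul_apply, Equiv.Perm.inv_eq_iff_eq.2 rfl,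
        moebius_coe, if_neg (by simp [ht]), hf, OnePoint.coe_eq_coe] at this
      rw [← this]
      congr 1
      field_simp
      ring
    have he : e = 0 := by simpa [hf0] using (h 0).symm
    have hc : f (t ^ 2) = c := by simpa [hf1, he] using h 1
    rw [h, hc, he, add_zero]
  obtain ⟨φ, hφ⟩ :=
    exists_ringAut_of_map_sq_mul (two_ne_zero_of_card_eq_sq hq hF) f hadd hsq
  refine ⟨φ, Equiv.ext fun z => ?_⟩
  cases z with
  | infty => exact hinf
  | coe z => exact (hf z).trans (congrArg OnePoint.some (hφ z).symm)

/-- The normalizer of `M(q ^ 2)` in the symmetric group on the projective line is `PΓL(2, F)`. -/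
theorem pGammaLPerm_range (hq : Odd q) (hF : Nat.card F = q ^ 2) :
    (pGammaLPerm F).range =
      Subgroup.normalizer (twistedLinFracGroup hF : Set (Equiv.Perm (OnePoint F))) := by
  refine le_antisymm (pGammaLPerm_range_le hq hF) fun π hπ => ?_
  obtain ⟨A, hA, hA0, hA1⟩ := exists_linFrac_apply_eq
    (x := π OnePoint.infty) (y := π (0 : F)) (z := π (1 : F))
    (π.injective.ne (OnePoint.infty_ne_coe _)) (π.injective.ne (OnePoint.infty_ne_coe _))
    (π.injective.ne (OnePoint.coe_injective.ne zero_ne_one))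
  obtain ⟨φ, hφ⟩ := exists_eq_fieldPerm_of_mem_normalizer hq
    (mul_mem (linFrac_mem_normalizer hq hF A) hπ) hA hA0 hA1
  refine ⟨⟨Matrix.ProjGenLinGroup.mk A⁻¹, φ⟩, ?_⟩
  rw [pGammaLPerm_mk, ← hφ]
  exact inv_mul_cancel_left (linFrac A) π

theorem nonempty_mulAut_twistedLinFracGroup_mulEquiv (hq : Odd q) (hF : Nat.card F = q ^ 2) :
    Nonempty (MulAut (twistedLinFracGroup hF) ≃* PGammaL2 F) :=
  ⟨(MulEquiv.ofBijective _ (normalizerMonoidHom_bijective hq hF)).symm.trans <|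
    (MulEquiv.subgroupCongr (pGammaLPerm_range hq hF)).symm.trans
      (MonoidHom.ofInjective pGammaLPerm_injective).symm⟩

end Normalizer

theorem mainTheorem4 :
    (∀ (G : Type*) [Group G] (U : Subgroup G), U.Characteristic → U.index = 2 →
      Subgroup.center U = ⊥ →
      (∀ α : MulAut U, ∃ β : MulAut G, ∀ u : U, β (u : G) = (α u : G)) →
      Nonempty (MulAut U ≃* MulAut G)) ∧
    (∀ (q : ℕ) (F : Type*) [Field F] [Finite F] [DecidableEq F], Odd q →
      ∀ hF : Nat.card F = q ^ 2,
      Nonempty (MulAut (twistedLinFracGroup hF) ≃* PGammaL2 F)) :=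
  ⟨fun _ _ U hU h2 hc hext =>
      nonempty_mulAut_mulEquiv_of_characteristic_of_index_eq_two U hU h2 hc hext,
    fun _ _ _ _ _ hq hF => nonempty_mulAut_twistedLinFracGroup_mulEquiv hq hF⟩
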